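/- Let $d\ge 1$, $D=[0,1]^d$ and $\Omega=D\times[0,1]$. Let $f\in C^1(\Omega,\mathbb{R}^d)$ (with derivatives continuous up to the boundary of the closed set $\Omega$) satisfy $f(x,t)\cdot\nu_x=0$ for all $t\in[0,1]$ and all $x\in\partial D$ at which the outward unit normal $\nu_x$ of $D$ is well defined. Then for every $x\in D$ the initial value problem \[ \tfrac{d}{dt}X^f(x,t)=f(X^f(x,t),t)\quad (t\in[0,1]),\qquad X^f(x,0)=x, \] has a unique solution $X^f(x,\cdot):[0,1]\to D$, and for every $t\in[0,1]$ the flow map $X^f(\cdot,t):D\to D$ is a $C^1$-diffeomorphism, that is, a bijection of $D$ which, together with its inverse, is continuously differentiable on $D$ (up to the boundary). In particular, the time-one map $T^f=X^f(\cdot,1):D\to D$ is a $C^1$-diffeomorphism. Moreover, for every Lebesgue probability density $\rho$ supported on $D$, the pullback density $(T^f)^\sharp\rho(x):=\rho(T^f(x))\,|\det\nabla T^f(x)|$, $x\in D$ (extended by zero off $D$), is a probability density, namely a Lebesgue density of the image of the measure $\rho(x)\,dx$ under $(T^f)^{-1}$, and it is given by \[ (T^f)^\sharp\rho(x)=\rho(T^f(x))\,\det\nabla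 T^f(x)\qquad\text{for every } x\in D . \] -/

import Mathlib

open Set MeasureTheory

noncomputable section

/-- The unit cube `[0,1]^d` in Euclidean space. -/
def unitCube (d : ℕ) : Set (EuclideanSpace ℝ (Fin d)) :=
  {x | ∀ i, x i ∈ Icc (0 : ℝ) 1}

/-- The space-time cylinder `[0,1]^d × [0,1]`. -/
def spaceTime (d : ℕ) : Set (EuclideanSpace ℝ (Fin d) × ℝ) :=
  unitCube d ×ˢ Icc (0 : ℝ) 1

/-- `ν` is an outward unit normal to the convex set `K` at `x`: it has length one and `K` lies in
the half space `{y | ⟪ν, y - x⟫ ≤ 0}`. -/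
def IsUnitNormal {d : ℕ} (K : Set (EuclideanSpace ℝ (Fin d))) (x ν : EuclideanSpace ℝ (Fin d)) :
    Prop :=
  ‖ν‖ = 1 ∧ ∀ y ∈ K, inner ℝ ν (y - x) ≤ 0

/-- The outward unit normal to the convex set `K` is well defined at `x` and equal to `ν`:
`ν` is the only outward unit normal at `x`. For the cube, this is the case exactly at the
relative interior points of the facets (not at edges or corners). -/
def HasOutwardNormal {d : ℕ} (K : Set (EuclideanSpace ℝ (Fin d)))
    (x ν : EuclideanSpace ℝ (Fin d)) : Prop :=
  IsUnitNormal K x ν ∧ ∀ ν', IsUnitNormal K x ν' → ν' = ν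

/-- Admissible velocity fields: `C^1` on the closed cylinder (with one-sided derivatives at its
boundary), with zero normal component on `∂D × [0,1]` wherever the normal is well defined. -/
def admissibleFields (d : ℕ) :
    Set (EuclideanSpace ℝ (Fin d) × ℝ → EuclideanSpace ℝ (Fin d)) :=
  {f | ContDiffOn ℝ 1 f (spaceTime d) ∧
    ∀ x ∈ frontier (unitCube d), ∀ ν, HasOutwardNormal (unitCube d) x ν →
      ∀ t ∈ Icc (0 : ℝ) 1, inner ℝ (f (x, t)) ν = 0}

/-- `γ` solves `γ'(t) = f(γ(t), t)` on `[0,1]` with `γ(0) = x`, and stays in the cube, where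
`f` is defined. -/
def IsTrajectory {d : ℕ} (f : EuclideanSpace ℝ (Fin d) × ℝ → EuclideanSpace ℝ (Fin d))
    (x : EuclideanSpace ℝ (Fin d)) (γ : ℝ → EuclideanSpace ℝ (Fin d)) : Prop :=
  γ 0 = x ∧ ∀ t ∈ Icc (0 : ℝ) 1,
    γ t ∈ unitCube d ∧ HasDerivWithinAt γ (f (γ t, t)) (Icc 0 1) t

open Classical in
/-- The flow `X^f(x,t)`: the value at time `t` of the trajectory of `f` that starts at `x`
(and `x` if there is no such trajectory). -/
def flowMap {d : ℕ} (f : EuclideanSpace ℝ (Fin d) × ℝ → EuclideanSpace ℝ (Fin d))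
    (x : EuclideanSpace ℝ (Fin d)) (t : ℝ) : EuclideanSpace ℝ (Fin d) :=
  if h : ∃ γ, IsTrajectory f x γ then h.choose t else x

/-- The time-one map `T^f = X^f(·,1)`. -/
def transportMap {d : ℕ} (f : EuclideanSpace ℝ (Fin d) × ℝ → EuclideanSpace ℝ (Fin d)) :
    EuclideanSpace ℝ (Fin d) → EuclideanSpace ℝ (Fin d) :=
  fun x => flowMap f x 1

/-- `T` restricts to a `C^1` diffeomorphism of `K` onto itself: a bijection of `K`, of class `C^1`
on `K` together with its inverse (up to the boundary of `K`). -/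
def IsC1Diffeo {d : ℕ} (K : Set (EuclideanSpace ℝ (Fin d)))
    (T : EuclideanSpace ℝ (Fin d) → EuclideanSpace ℝ (Fin d)) : Prop :=
  BijOn T K K ∧ ContDiffOn ℝ 1 T K ∧ ContDiffOn ℝ 1 (Function.invFunOn T K) K

/-- The Jacobian determinant `det ∇T(x)` of a map on `K`. -/
def jacobianDet {d : ℕ} (K : Set (EuclideanSpace ℝ (Fin d)))
    (T : EuclideanSpace ℝ (Fin d) → EuclideanSpace ℝ (Fin d)) (x : EuclideanSpace ℝ (Fin d)) : ℝ :=
  (fderivWithin ℝ T K x).det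

/-- `p` is a Lebesgue probability density supported on `K`. -/
structure IsDensityOn {d : ℕ} (K : Set (EuclideanSpace ℝ (Fin d)))
    (p : EuclideanSpace ℝ (Fin d) → ℝ) : Prop where
  aemeasurable : AEMeasurable p
  nonneg : ∀ x, 0 ≤ p x
  support_subset : Function.support p ⊆ K
  lintegral_eq_one : ∫⁻ x, ENNReal.ofReal (p x) = 1

/-- The measure `p(x) dx`. -/
def densityMeasure {d : ℕ} (p : EuclideanSpace ℝ (Fin d) → ℝ) :
    Measure (EuclideanSpace ℝ (Fin d)) :=
  volume.withDensity fun x => ENNReal.ofReal (p x)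

/-- The pullback density `T^♯ρ(x) = ρ(T(x)) |det ∇T(x)|`, `x ∈ K`, extended by zero off `K`. -/
def pullbackDensity {d : ℕ} (K : Set (EuclideanSpace ℝ (Fin d)))
    (T : EuclideanSpace ℝ (Fin d) → EuclideanSpace ℝ (Fin d))
    (ρ : EuclideanSpace ℝ (Fin d) → ℝ) : EuclideanSpace ℝ (Fin d) → ℝ :=
  K.indicator fun x => ρ (T x) * |jacobianDet K T x|

end

open Filter Topology
open scoped NNReal

/-! ### Solutions on [0,1], Grönwall bounds and a barrier argument -/

section ODE

variable {E : Type*} [NormedAddCommGroup E] [NormedSpace ℝ E]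

/-! Tangency holds a priori only inside the facets; by continuity of `f` it extends to edges and
corners (`apply_eq_zero_of_facet`). Extend `f` by clamping the space variable to the cube: the
extension is bounded and Lipschitz, so it has solutions on [0,1]. Its i-th component vanishes as
soon as the i-th coordinate leaves (0,1), so no coordinate can escape (`exists_isTrajectory`).
Grönwall gives uniqueness.

The spatial derivative of the flow is the fundamental solution of the linearized equation: Grönwall
controls the remainder, with uniformity from compactness of the cylinder (`exists_flowMap_deriv`).
Every time-t map is a time-one map of a rescaled field, and reversing time inverts it, so the
inverse is again a C^1 flow map (`isC1Diffeo_flowMap`).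

The Jacobian determinant is 1 at time 0, continuous in time and never zero, hence positive. The
density claims are the change of variables formula for an injective map. -/

theorem exists_solution_of_bounded_lipschitz [CompleteSpace E] {F : ℝ → E → E} {K M : ℝ≥0}
    (hF : ∀ t ∈ Icc (0 : ℝ) 1, LipschitzWith K (F t))
    (hc : ∀ x, ContinuousOn (fun t => F t x) (Icc 0 1))
    (hM : ∀ t ∈ Icc (0 : ℝ) 1, ∀ x, ‖F t x‖ ≤ M) (x₀ : E) :
    ∃ γ : ℝ → E, γ 0 = x₀ ∧
      ∀ t ∈ Icc (0 : ℝ) 1, HasDerivWithinAt γ (F t (γ t)) (Icc 0 1) t := by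
  -- The global speed bound M makes a ball of radius M large enough for the whole unit time
  -- interval.
  have h : IsPicardLindelof F (tmin := 0) (tmax := 1) ⟨0, by simp⟩ x₀ M 0 M K :=
    { lipschitzOnWith := fun t ht => (hF t ht).lipschitzOnWith
      continuousOn := fun x _ => hc x
      norm_le := fun t ht x _ => hM t ht x
      mul_max_le := by simp }
  obtain ⟨γ, h0, h1⟩ := h.exists_eq_forall_mem_Icc_hasDerivWithinAt₀
  exact ⟨γ, h0, h1⟩

theorem HasDerivWithinAt.Ici_of_Icc {γ : ℝ → E} {v : E} {a b t : ℝ} (ht : t ∈ Ico a b)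
    (h : HasDerivWithinAt γ v (Icc a b) t) : HasDerivWithinAt γ v (Ici t) t :=
  h.mono_of_mem_nhdsWithin <| mem_of_superset (Icc_mem_nhdsGE ht.2) (Icc_subset_Icc_left ht.1)

/-- Grönwall at time 1, with rate K + 1 in place of K: this avoids the degenerate case K = 0 and
makes ε / (K + 1) ≤ ε. -/
theorem norm_le_of_norm_deriv_le {w w' : ℝ → E} {δ K ε : ℝ} (hδ : 0 ≤ δ) (hK : 0 ≤ K)
    (hε : 0 ≤ ε) (hw : ∀ t ∈ Icc (0 : ℝ) 1, HasDerivWithinAt w (w' t) (Icc 0 1) t)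
    (h0 : ‖w 0‖ ≤ δ) (hb : ∀ t ∈ Icc (0 : ℝ) 1, ‖w' t‖ ≤ K * ‖w t‖ + ε) :
    ∀ t ∈ Icc (0 : ℝ) 1, ‖w t‖ ≤ (δ + ε) * Real.exp (K + 1) := by
  intro t ht
  have h := norm_le_gronwallBound_of_norm_deriv_right_le (K := K + 1) (ε := ε) (δ := δ)
    (fun s hs => (hw s hs).continuousWithinAt)
    (fun s hs => (hw s (Ico_subset_Icc_self hs)).Ici_of_Icc hs) h0
    (fun s hs => (hb s (Ico_subset_Icc_self hs)).trans
      (by nlinarith [norm_nonneg (w s)])) t ht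
  have hmono := gronwallBound_mono hδ hε (by linarith : 0 ≤ K + 1) (sub_le_self t (le_refl 0) |>.trans ht.2)
  refine (h.trans hmono).trans ?_
  rw [gronwallBound_of_K_ne_0 (by linarith)]
  have h1 : ε / (K + 1) ≤ ε := div_le_self hε (by linarith)
  have h2 : 0 ≤ Real.exp (K + 1) - 1 := by
    have := Real.add_one_le_exp (K + 1); linarith
  have h3 := mul_le_mul_of_nonneg_right h1 h2
  simp only [mul_one]
  nlinarith

/-- Compare -u with the barrier ε/2 + (ε/2)s. Where they touch, u is negative, so -u has slope 0,
less than that of the barrier; then let ε tend to 0. -/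
theorem nonneg_of_deriv_eq_zero_of_nonpos {u u' : ℝ → ℝ}
    (hu : ∀ t ∈ Icc (0 : ℝ) 1, HasDerivWithinAt u (u' t) (Icc 0 1) t) (h0 : 0 ≤ u 0)
    (hz : ∀ t ∈ Icc (0 : ℝ) 1, u t ≤ 0 → u' t = 0) : ∀ t ∈ Icc (0 : ℝ) 1, 0 ≤ u t := by
  intro t ht
  refine le_of_forall_pos_le_add fun ε hε => ?_
  have key := image_le_of_deriv_right_lt_deriv_boundary (f := fun s => -u s)
    (f' := fun s => -u' s) (B := fun s => ε / 2 + ε / 2 * s) (B' := fun _ => ε / 2)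
    (a := 0) (b := 1)
    (fun s hs => (hu s hs).continuousWithinAt.neg)
    (fun s hs => ((hu s (Ico_subset_Icc_self hs)).Ici_of_Icc hs).neg)
    (by simp; linarith)
    (fun s => by simpa using ((hasDerivAt_id s).const_mul (ε / 2)).const_add (ε / 2))
    (fun s hs he => by
      have hs' := Ico_subset_Icc_self hs
      have : u s ≤ 0 := by nlinarith [hs.1]
      rw [hz s hs' this]; linarith)
  have := key ht
  nlinarith [ht.1, ht.2]

end ODE

/-! ### Truncation to a box and linear equations -/

section Clamp

variable {d : ℕ}

/-- The coordinatewise projection onto `[a,b]^d`. -/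
noncomputable def clamp (a b : ℝ) (x : EuclideanSpace ℝ (Fin d)) : EuclideanSpace ℝ (Fin d) :=
  WithLp.toLp 2 fun i => max a (min b (x i))

@[simp] theorem clamp_apply (a b : ℝ) (x : EuclideanSpace ℝ (Fin d)) (i : Fin d) :
    clamp a b x i = max a (min b (x i)) := rfl

theorem lipschitzWith_clamp (a b : ℝ) :
    LipschitzWith 1 (clamp a b : EuclideanSpace ℝ (Fin d) → EuclideanSpace ℝ (Fin d)) := by
  refine LipschitzWith.of_dist_le_mul fun x y => ?_
  rw [NNReal.coe_one, one_mul, EuclideanSpace.dist_eq, EuclideanSpace.dist_eq]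
  refine Real.sqrt_le_sqrt (Finset.sum_le_sum fun i _ => ?_)
  refine pow_le_pow_left₀ dist_nonneg ?_ 2
  rw [clamp_apply, clamp_apply, Real.dist_eq, Real.dist_eq, max_comm a, max_comm a, min_comm b,
    min_comm b]
  exact (abs_max_sub_max_le_abs _ _ _).trans (abs_min_sub_min_le_max _ _ _ _ |>.trans (by simp))

theorem clamp_eq_self {a b : ℝ} {x : EuclideanSpace ℝ (Fin d)} (h : ∀ i, x i ∈ Icc a b) :
    clamp a b x = x := by
  ext i
  simp [(h i).1, (h i).2]

theorem clamp_mem_Icc {a b : ℝ} (hab : a ≤ b) (x : EuclideanSpace ℝ (Fin d)) (i : Fin d) :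
    clamp a b x i ∈ Icc a b := by
  simp [hab]

theorem norm_clamp_le {R : ℝ} (hR : 0 ≤ R) (x : EuclideanSpace ℝ (Fin d)) :
    ‖clamp (-R) R x‖ ≤ ‖x‖ := by
  have h := (lipschitzWith_clamp (d := d) (-R) R).dist_le_mul x 0
  rw [clamp_eq_self (x := 0) (by simp [hR])] at h
  simpa using h

theorem norm_le_sqrt_mul {R : ℝ} {x : EuclideanSpace ℝ (Fin d)} (h : ∀ i, |x i| ≤ R) :
    ‖x‖ ≤ √(d * R ^ 2) := by
  rw [EuclideanSpace.norm_eq]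
  refine Real.sqrt_le_sqrt ?_
  calc ∑ i, ‖x i‖ ^ 2 ≤ ∑ _i : Fin d, R ^ 2 :=
        Finset.sum_le_sum fun i _ => pow_le_pow_left₀ (norm_nonneg _) (h i) 2
    _ = d * R ^ 2 := by simp

/-- A linear field is unbounded, so it is truncated at the a priori Grönwall bound R. Clamping does
not increase the norm, so the truncated solution obeys the same bound and never feels the
truncation. -/
theorem exists_solution_linear {A : ℝ → EuclideanSpace ℝ (Fin d) →L[ℝ] EuclideanSpace ℝ (Fin d)}
    (hA : ContinuousOn A (Icc 0 1)) (v₀ : EuclideanSpace ℝ (Fin d)) :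
    ∃ v : ℝ → EuclideanSpace ℝ (Fin d), v 0 = v₀ ∧
      ∀ t ∈ Icc (0 : ℝ) 1, HasDerivWithinAt v (A t (v t)) (Icc 0 1) t := by
  obtain ⟨C, hC⟩ := isCompact_Icc.exists_bound_of_continuousOn hA
  have hC0 : 0 ≤ C := (norm_nonneg _).trans (hC 0 (by simp))
  set R := ‖v₀‖ * Real.exp (C + 1) with hR
  have hR0 : 0 ≤ R := by positivity
  obtain ⟨v, hv0, hv⟩ := exists_solution_of_bounded_lipschitz
    (F := fun t x => A t (clamp (-R) R x)) (K := C.toNNReal) (M := (C * √(d * R ^ 2)).toNNReal)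
    (fun t ht => by
      refine LipschitzWith.of_dist_le_mul fun x y => ?_
      rw [dist_eq_norm, ← map_sub, Real.coe_toNNReal _ hC0]
      refine ((A t).le_of_opNorm_le (hC t ht) _).trans ?_
      gcongr
      simpa [dist_eq_norm] using (lipschitzWith_clamp (-R) R).dist_le_mul x y)
    (fun x => hA.clm_apply continuousOn_const)
    (fun t ht x => by
      rw [Real.coe_toNNReal _ (by positivity)]
      refine ((A t).le_of_opNorm_le (hC t ht) _).trans ?_
      gcongr
      exact norm_le_sqrt_mul fun i => abs_le.2 (clamp_mem_Icc (by linarith) x i)) v₀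
  refine ⟨v, hv0, fun t ht => ?_⟩
  have hb := norm_le_of_norm_deriv_le (norm_nonneg v₀) hC0 le_rfl hv (by rw [hv0])
    (fun t ht => by
      rw [add_zero]
      refine ((A t).le_of_opNorm_le (hC t ht) _).trans ?_
      gcongr
      exact norm_clamp_le hR0 _) t ht
  have hvt : clamp (-R) R (v t) = v t :=
    clamp_eq_self fun i => abs_le.1 <| (PiLp.norm_apply_le (v t) i).trans (by simpa using hb)
  simpa [hvt] using hv t ht

theorem exists_fundamental_solution
    {A : ℝ → EuclideanSpace ℝ (Fin d) →L[ℝ] EuclideanSpace ℝ (Fin d)}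
    (hA : ContinuousOn A (Icc 0 1)) :
    ∃ V : ℝ → EuclideanSpace ℝ (Fin d) →L[ℝ] EuclideanSpace ℝ (Fin d),
      V 0 = ContinuousLinearMap.id ℝ _ ∧
      ∀ t ∈ Icc (0 : ℝ) 1, HasDerivWithinAt V (A t ∘L V t) (Icc 0 1) t := by
  choose v hv0 hv using fun i : Fin d =>
    exists_solution_linear hA (EuclideanSpace.single i (1 : ℝ))
  have hsum : ∀ x : EuclideanSpace ℝ (Fin d), ∑ i, x i • EuclideanSpace.single i (1 : ℝ) = x := by
    intro x
    ext j
    simp [Pi.single_apply]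
  refine ⟨fun t => ∑ i, (EuclideanSpace.proj i).smulRight (v i t), ?_, fun t ht => ?_⟩
  · ext1 x
    simp [hv0, hsum]
  · have h := HasDerivWithinAt.fun_sum (u := Finset.univ) fun i _ =>
      (ContinuousLinearMap.smulRightL ℝ (EuclideanSpace ℝ (Fin d)) _
        (EuclideanSpace.proj i)).hasFDerivAt.comp_hasDerivWithinAt t (hv i t ht)
    refine h.congr_deriv ?_
    ext1 x
    simp [map_sum]

end Clamp

/-! ### Geometry and normals of the cube -/

section Cube

variable {d : ℕ}

theorem convex_unitCube : Convex ℝ (unitCube d) := by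
  intro x hx y hy a b ha hb hab i
  exact convex_Icc (0 : ℝ) 1 (hx i) (hy i) ha hb hab

theorem isClosed_unitCube : IsClosed (unitCube d) := by
  simp only [unitCube, ofPred_forall]
  exact isClosed_iInter fun i => isClosed_Icc.preimage (EuclideanSpace.proj (𝕜 := ℝ) i).continuous

theorem isCompact_unitCube : IsCompact (unitCube d) := by
  refine Metric.isCompact_of_isClosed_isBounded isClosed_unitCube ?_
  refine (Metric.isBounded_closedBall (x := 0) (r := √(d * 1 ^ 2))).subset fun x hx => ?_
  rw [mem_closedBall_zero_iff]
  exact norm_le_sqrt_mul fun i => abs_le.2 ⟨by linarith [(hx i).1], (hx i).2⟩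

theorem interior_unitCube_nonempty : (interior (unitCube d)).Nonempty := by
  refine ⟨WithLp.toLp 2 fun _ => 1 / 2, mem_interior.2
    ⟨⋂ i, (EuclideanSpace.proj (𝕜 := ℝ) i) ⁻¹' Ioo (0 : ℝ) 1, ?_, ?_, ?_⟩⟩
  · exact fun x hx i => Ioo_subset_Icc_self (mem_iInter.1 hx i)
  · exact isOpen_iInter_of_finite fun i =>
      isOpen_Ioo.preimage (EuclideanSpace.proj (𝕜 := ℝ) i).continuous
  · refine mem_iInter.2 fun i => ?_
    simp only [mem_preimage, PiLp.proj_apply, mem_Ioo]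
    norm_num

theorem uniqueDiffOn_unitCube : UniqueDiffOn ℝ (unitCube d) :=
  uniqueDiffOn_convex convex_unitCube interior_unitCube_nonempty

theorem isCompact_spaceTime : IsCompact (spaceTime d) := isCompact_unitCube.prod isCompact_Icc

theorem uniqueDiffOn_spaceTime : UniqueDiffOn ℝ (spaceTime d) :=
  uniqueDiffOn_unitCube.prod (uniqueDiffOn_Icc zero_lt_one)

theorem clamp_mem_unitCube (x : EuclideanSpace ℝ (Fin d)) : clamp 0 1 x ∈ unitCube d :=
  clamp_mem_Icc zero_le_one x

theorem IsUnitNormal.notMem_interior {K : Set (EuclideanSpace ℝ (Fin d))}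
    {x ν : EuclideanSpace ℝ (Fin d)} (h : IsUnitNormal K x ν) : x ∉ interior K := by
  intro hx
  have hc : Tendsto (fun ε : ℝ => x + ε • ν) (𝓝[>] 0) (𝓝 x) := by
    have : Continuous fun ε : ℝ => x + ε • ν := by fun_prop
    simpa using (this.tendsto 0).mono_left nhdsWithin_le_nhds
  obtain ⟨ε, hε, hε0⟩ :=
    ((hc.eventually (mem_interior_iff_mem_nhds.1 hx)).and self_mem_nhdsWithin).exists
  have := h.2 _ hε
  rw [add_sub_cancel_left, inner_smul_right, real_inner_self_eq_norm_sq, h.1] at this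
  simp at this
  exact absurd hε0 (not_lt.2 this)

/-- On the relative interior of the facets `x i = 1` (`σ = 1`) and `x i = 0` (`σ = -1`) the outward
normal is `σ eᵢ`. -/
theorem hasOutwardNormal_facet {x : EuclideanSpace ℝ (Fin d)} {i : Fin d} {σ : ℝ}
    (hσ : σ = 1 ∧ x i = 1 ∨ σ = -1 ∧ x i = 0) (hx : ∀ j ≠ i, x j ∈ Ioo (0 : ℝ) 1) :
    HasOutwardNormal (unitCube d) x (EuclideanSpace.single i σ) := by
  have hxi : x i ∈ Icc (0 : ℝ) 1 := by rcases hσ with ⟨-, h⟩ | ⟨-, h⟩ <;> simp [h]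
  have hxD : ∀ j, x j ∈ Icc (0 : ℝ) 1 := fun j => by
    by_cases hj : j = i
    · exact hj ▸ hxi
    · exact Ioo_subset_Icc_self (hx j hj)
  refine ⟨⟨by rcases hσ with ⟨h, -⟩ | ⟨h, -⟩ <;> simp [h], fun y hy => ?_⟩, fun ν hν => ?_⟩
  · rw [EuclideanSpace.inner_single_left]
    have := hy i
    rcases hσ with ⟨h, h'⟩ | ⟨h, h'⟩ <;> simp [h, h', this.1, this.2]
  -- Test a normal against moves along one axis. Coordinates in (0,1) move both ways, forcing ν j =
  -- 0; coordinate i moves one way only, which fixes the sign of ν i.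
  · have key : ∀ j (s : ℝ), x j + s ∈ Icc (0 : ℝ) 1 → s * ν j ≤ 0 := fun j s hs => by
      have := hν.2 (x + EuclideanSpace.single j s) fun k => by
        by_cases hk : k = j
        · subst hk; simpa using hs
        · simpa [hk] using hxD k
      rw [add_sub_cancel_left, EuclideanSpace.inner_single_right] at this
      simpa using this
    have hz : ∀ j ≠ i, ν j = 0 := fun j hj => by
      have h1 := key j (1 - x j) (by simp)
      have h2 := key j (- x j) (by simp)
      have h3 := hx j hj
      nlinarith [h3.1, h3.2]
    have hν' : ν = EuclideanSpace.single i (ν i) := by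
      ext j
      by_cases hj : j = i
      · subst hj; simp
      · simp [hj, hz j hj]
    have hn := hν.1
    rw [hν', PiLp.norm_single, Real.norm_eq_abs] at hn
    rw [hν']
    congr 1
    rcases hσ with ⟨h, h'⟩ | ⟨h, h'⟩
    · have := key i (-1) (by simp [h'])
      rw [abs_of_nonneg (by linarith)] at hn
      rw [hn, h]
    · have := key i 1 (by simp [h'])
      rw [abs_of_nonpos (by linarith)] at hn
      rw [h]; linarith

end Cube

/-! ### Tangency at the boundary, spatial derivative, trajectories -/

section Field

variable {d : ℕ} {f : EuclideanSpace ℝ (Fin d) × ℝ → EuclideanSpace ℝ (Fin d)}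

/-- At edges and corners no normal is defined. The segment from x to the centre c of the facet lies,
except perhaps for x itself, in the relative interior of the facet; the value at x follows by
continuity. -/
theorem apply_eq_zero_of_facet (hf : f ∈ admissibleFields d) {x : EuclideanSpace ℝ (Fin d)}
    (hx : x ∈ unitCube d) {t : ℝ} (ht : t ∈ Icc (0 : ℝ) 1) {i : Fin d} (hxi : x i = 0 ∨ x i = 1) :
    f (x, t) i = 0 := by
  obtain ⟨σ, hσ⟩ : ∃ σ : ℝ, σ = 1 ∧ x i = 1 ∨ σ = -1 ∧ x i = 0 := by
    rcases hxi with h | h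
    exacts [⟨-1, .inr ⟨rfl, h⟩⟩, ⟨1, .inl ⟨rfl, h⟩⟩]
  have hσ0 : σ ≠ 0 := by rcases hσ with ⟨h, -⟩ | ⟨h, -⟩ <;> simp [h]
  set c : EuclideanSpace ℝ (Fin d) := WithLp.toLp 2 (Function.update (fun _ => 1 / 2) i (x i))
    with hc
  have hci : c i = x i := by simp [hc]
  have hcj : ∀ j ≠ i, c j = 1 / 2 := fun j hj => by simp [hc, hj]
  have hcD : c ∈ unitCube d := fun j => by
    by_cases hj : j = i
    · subst hj; rw [hci]; exact hx j
    · rw [hcj j hj]; norm_num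
  set p : ℝ → EuclideanSpace ℝ (Fin d) := fun ε => (1 - ε) • x + ε • c
  have hpD : MapsTo p (Icc 0 1) (unitCube d) := fun ε hε =>
    convex_unitCube hx hcD (by linarith [hε.2]) hε.1 (by ring)
  have hpc : Continuous p := by fun_prop
  have hcont : ContinuousOn (fun ε => f (p ε, t) i) (Icc 0 1) :=
    (EuclideanSpace.proj (𝕜 := ℝ) i).continuous.comp_continuousOn <| hf.1.continuousOn.comp
      (hpc.prodMk continuous_const).continuousOn fun ε hε => ⟨hpD hε, ht⟩
  have hzero : ∀ ε ∈ Ioc (0 : ℝ) 1, f (p ε, t) i = 0 := fun ε hε => by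
    have hε' := Ioc_subset_Icc_self hε
    have hpi : p ε i = x i := by simp [p, hci]; ring
    have hN : HasOutwardNormal (unitCube d) (p ε) (EuclideanSpace.single i σ) := by
      refine hasOutwardNormal_facet (by rwa [hpi]) fun j hj => ?_
      have := hx j
      simp only [p, PiLp.add_apply, PiLp.smul_apply, smul_eq_mul, hcj j hj, mem_Ioo]
      constructor <;> nlinarith [this.1, this.2, hε.1, hε.2]
    have := hf.2 (p ε) (by
      rw [isClosed_unitCube.frontier_eq]
      exact ⟨hpD hε', hN.1.notMem_interior⟩) _ hN t ht
    rw [EuclideanSpace.inner_single_right] at this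
    simpa [hσ0] using this
  have h0 : (0 : ℝ) ∈ closure (Ioc (0 : ℝ) 1) := by
    rw [closure_Ioc zero_ne_one]; simp
  have := EqOn.of_subset_closure (f := fun ε => f (p ε, t) i) (g := fun _ => (0 : ℝ)) (s := Ioc 0 1)
    (t := Icc 0 1) hzero hcont continuousOn_const Ioc_subset_Icc_self
    (by rw [closure_Ioc zero_ne_one]) (left_mem_Icc.2 zero_le_one)
  simpa [p] using this

/-- The partial derivative of `f` in the space variable. -/
noncomputable def spaceDeriv (f : EuclideanSpace ℝ (Fin d) × ℝ → EuclideanSpace ℝ (Fin d))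
    (p : EuclideanSpace ℝ (Fin d) × ℝ) : EuclideanSpace ℝ (Fin d) →L[ℝ] EuclideanSpace ℝ (Fin d) :=
  fderivWithin ℝ f (spaceTime d) p ∘L ContinuousLinearMap.inl ℝ _ _

theorem continuousOn_spaceDeriv (hf : ContDiffOn ℝ 1 f (spaceTime d)) :
    ContinuousOn (spaceDeriv f) (spaceTime d) :=
  (hf.continuousOn_fderivWithin uniqueDiffOn_spaceTime le_rfl).clm_comp continuousOn_const

theorem hasFDerivWithinAt_spaceDeriv (hf : ContDiffOn ℝ 1 f (spaceTime d))
    {x : EuclideanSpace ℝ (Fin d)} (hx : x ∈ unitCube d) {t : ℝ} (ht : t ∈ Icc (0 : ℝ) 1) :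
    HasFDerivWithinAt (fun y => f (y, t)) (spaceDeriv f (x, t)) (unitCube d) x :=
  have hmaps : MapsTo (fun y => (y, t)) (unitCube d) (spaceTime d) := fun _ hy => ⟨hy, ht⟩
  (hf.differentiableOn one_ne_zero (x, t) ⟨hx, ht⟩).hasFDerivWithinAt.comp x
    (hasFDerivAt_prodMk_left x t).hasFDerivWithinAt hmaps

theorem exists_spaceDeriv_bound (hf : ContDiffOn ℝ 1 f (spaceTime d)) :
    ∃ K : ℝ≥0, (∀ p ∈ spaceTime d, ‖spaceDeriv f p‖ ≤ K) ∧
      ∀ t ∈ Icc (0 : ℝ) 1, LipschitzOnWith K (fun x => f (x, t)) (unitCube d) := by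
  obtain ⟨C, hC⟩ := isCompact_spaceTime.exists_bound_of_continuousOn (continuousOn_spaceDeriv hf)
  have hC' : ∀ p ∈ spaceTime d, ‖spaceDeriv f p‖ ≤ C.toNNReal :=
    fun p hp => (hC p hp).trans (Real.le_coe_toNNReal C)
  exact ⟨C.toNNReal, hC', fun t ht => convex_unitCube.lipschitzOnWith_of_nnnorm_hasFDerivWithin_le
    (fun x hx => hasFDerivWithinAt_spaceDeriv hf hx ht) fun x hx => hC' _ ⟨hx, ht⟩⟩

theorem exists_spaceDeriv_modulus (hf : ContDiffOn ℝ 1 f (spaceTime d)) {ε : ℝ} (hε : 0 < ε) :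
    ∃ δ > 0, ∀ t ∈ Icc (0 : ℝ) 1, ∀ x ∈ unitCube d, ∀ y ∈ unitCube d, dist y x < δ →
      ‖spaceDeriv f (y, t) - spaceDeriv f (x, t)‖ ≤ ε := by
  obtain ⟨δ, hδ, h⟩ := Metric.uniformContinuousOn_iff.1
    (isCompact_spaceTime.uniformContinuousOn_of_continuous (continuousOn_spaceDeriv hf)) ε hε
  refine ⟨δ, hδ, fun t ht x hx y hy hxy => ?_⟩
  rw [← dist_eq_norm]
  have hd : dist (y, t) (x, t) < δ := by rwa [Prod.dist_eq, dist_self, max_eq_left dist_nonneg]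
  exact (h _ ⟨hy, ht⟩ _ ⟨hx, ht⟩ hd).le

/-- Mean value inequality on the convex set cube ∩ ball, where the derivative varies by at most ε.
-/
theorem exists_linearization_modulus (hf : ContDiffOn ℝ 1 f (spaceTime d)) {ε : ℝ} (hε : 0 < ε) :
    ∃ δ > 0, ∀ t ∈ Icc (0 : ℝ) 1, ∀ x ∈ unitCube d, ∀ y ∈ unitCube d, dist y x < δ →
      ‖f (y, t) - f (x, t) - spaceDeriv f (x, t) (y - x)‖ ≤ ε * ‖y - x‖ := by
  obtain ⟨δ, hδ, h⟩ := exists_spaceDeriv_modulus hf hε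
  refine ⟨δ, hδ, fun t ht x hx y hy hxy => ?_⟩
  exact (convex_unitCube.inter (convex_ball x δ)).norm_image_sub_le_of_norm_hasFDerivWithin_le'
    (fun z hz => (hasFDerivWithinAt_spaceDeriv hf hz.1 ht).mono inter_subset_left)
    (fun z hz => h t ht x hx z hz.1 hz.2) ⟨hx, Metric.mem_ball_self hδ⟩ ⟨hy, hxy⟩

theorem exists_isTrajectory (hf : f ∈ admissibleFields d) {x : EuclideanSpace ℝ (Fin d)}
    (hx : x ∈ unitCube d) : ∃ γ, IsTrajectory f x γ := by
  obtain ⟨K, -, hK⟩ := exists_spaceDeriv_bound hf.1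
  obtain ⟨M, hM⟩ := isCompact_spaceTime.exists_bound_of_continuousOn hf.1.continuousOn
  obtain ⟨γ, h0, hγ⟩ := exists_solution_of_bounded_lipschitz (M := M.toNNReal)
    (F := fun t y => f (clamp 0 1 y, t)) (K := K * 1)
    (fun t ht => lipschitzOnWith_univ.1 <| (hK t ht).comp (lipschitzWith_clamp 0 1).lipschitzOnWith
      fun y _ => clamp_mem_unitCube y)
    (fun y => hf.1.continuousOn.comp (by fun_prop) fun t ht => ⟨clamp_mem_unitCube y, ht⟩)
    (fun t ht y => (hM _ ⟨clamp_mem_unitCube y, ht⟩).trans (Real.le_coe_toNNReal M)) x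
  have hcoord : ∀ i, ∀ t ∈ Icc (0 : ℝ) 1,
      HasDerivWithinAt (fun s => γ s i) (f (clamp 0 1 (γ t), t) i) (Icc 0 1) t := fun i t ht =>
    (EuclideanSpace.proj (𝕜 := ℝ) i).hasFDerivAt.comp_hasDerivWithinAt t (hγ t ht)
  have hmem : ∀ t ∈ Icc (0 : ℝ) 1, γ t ∈ unitCube d := fun t ht i => by
    constructor
    -- When γ s i ≤ 0, the clamped point lies on the facet where coordinate i is 0, so the velocity
    -- in that direction is zero. The upper bound is the same argument for 1 - γ s i.
    · refine nonneg_of_deriv_eq_zero_of_nonpos (hcoord i) (by rw [h0]; exact (hx i).1)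
        (fun s hs h => ?_) t ht
      refine apply_eq_zero_of_facet hf (clamp_mem_unitCube _) hs (.inl ?_)
      simp [h]
    · have := nonneg_of_deriv_eq_zero_of_nonpos (fun s hs => (hcoord i s hs).const_sub 1)
        (by rw [h0]; linarith [(hx i).2]) (fun s hs h => ?_) t ht
      · linarith
      rw [neg_eq_zero]
      refine apply_eq_zero_of_facet hf (clamp_mem_unitCube _) hs (.inr ?_)
      simp [show 1 ≤ γ s i by linarith]
  refine ⟨γ, h0, fun t ht => ⟨hmem t ht, ?_⟩⟩
  simpa [clamp_eq_self (hmem t ht)] using hγ t ht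

theorem IsTrajectory.dist_le {K : ℝ≥0}
    (hK : ∀ t ∈ Icc (0 : ℝ) 1, LipschitzOnWith K (fun x => f (x, t)) (unitCube d))
    {x y : EuclideanSpace ℝ (Fin d)} {γ η : ℝ → EuclideanSpace ℝ (Fin d)}
    (hγ : IsTrajectory f x γ) (hη : IsTrajectory f y η) {t : ℝ} (ht : t ∈ Icc (0 : ℝ) 1) :
    ‖γ t - η t‖ ≤ ‖x - y‖ * Real.exp (K + 1) := by
  have := norm_le_of_norm_deriv_le (w := fun t => γ t - η t) (norm_nonneg (x - y)) K.2 le_rfl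
    (fun t ht => (hγ.2 t ht).2.sub (hη.2 t ht).2) (by rw [hγ.1, hη.1]) (fun t ht => by
      have := (hK t ht).dist_le_mul _ (hγ.2 t ht).1 _ (hη.2 t ht).1
      simpa [dist_eq_norm] using this) t ht
  simpa using this

theorem IsTrajectory.eqOn (hf : ContDiffOn ℝ 1 f (spaceTime d)) {x : EuclideanSpace ℝ (Fin d)}
    {γ η : ℝ → EuclideanSpace ℝ (Fin d)} (hγ : IsTrajectory f x γ) (hη : IsTrajectory f x η) :
    EqOn γ η (Icc 0 1) := fun t ht => by
  obtain ⟨K, -, hK⟩ := exists_spaceDeriv_bound hf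
  have := hγ.dist_le hK hη ht
  simpa [sub_eq_zero] using this

theorem isTrajectory_flowMap (hf : f ∈ admissibleFields d) {x : EuclideanSpace ℝ (Fin d)}
    (hx : x ∈ unitCube d) : IsTrajectory f x (flowMap f x) := by
  have h := exists_isTrajectory hf hx
  have : flowMap f x = h.choose := by
    funext t
    simp only [flowMap, dif_pos h]
  exact this ▸ h.choose_spec

end Field

/-! ### Smoothness, inversion and Jacobian of the flow -/

section Flow

variable {d : ℕ} {f : EuclideanSpace ℝ (Fin d) × ℝ → EuclideanSpace ℝ (Fin d)}

/-- Differentiability of the flow in the initial value; the derivative solves the linearized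
equation. -/
theorem exists_flowMap_deriv (hf : f ∈ admissibleFields d) :
    ∃ V : EuclideanSpace ℝ (Fin d) → ℝ → EuclideanSpace ℝ (Fin d) →L[ℝ] EuclideanSpace ℝ (Fin d),
      (∀ x ∈ unitCube d, V x 0 = ContinuousLinearMap.id ℝ _ ∧ ContinuousOn (V x) (Icc 0 1)) ∧
      ∀ t ∈ Icc (0 : ℝ) 1,
        (∀ x ∈ unitCube d,
          HasFDerivWithinAt (fun y => flowMap f y t) (V x t) (unitCube d) x) ∧
        ContinuousOn (fun x => V x t) (unitCube d) := by
  obtain ⟨K, hAK, hK⟩ := exists_spaceDeriv_bound hf.1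
  have hX := fun x hx => isTrajectory_flowMap hf (x := x) hx
  have hst : ∀ x ∈ unitCube d, ∀ t ∈ Icc (0 : ℝ) 1, (flowMap f x t, t) ∈ spaceTime d :=
    fun x hx t ht => ⟨((hX x hx).2 t ht).1, ht⟩
  set A := fun x t => spaceDeriv f (flowMap f x t, t)
  have hA : ∀ x ∈ unitCube d, ContinuousOn (A x) (Icc 0 1) := fun x hx =>
    (continuousOn_spaceDeriv hf.1).comp (ContinuousOn.prodMk
      (fun t ht => ((hX x hx).2 t ht).2.continuousWithinAt) continuousOn_id) (hst x hx)
  choose! V hV0 hV using fun x hx => exists_fundamental_solution (hA x hx)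
  set M := Real.exp (K + 1) with hM
  have hM0 : 0 < M := Real.exp_pos _
  have hlip : ∀ x ∈ unitCube d, ∀ y ∈ unitCube d, ∀ t ∈ Icc (0 : ℝ) 1,
      ‖flowMap f y t - flowMap f x t‖ ≤ ‖y - x‖ * M :=
    fun x hx y hy t ht => (hX y hy).dist_le hK (hX x hx) ht
  have hVM : ∀ x ∈ unitCube d, ∀ t ∈ Icc (0 : ℝ) 1, ‖V x t‖ ≤ M := fun x hx t ht => by
    have := norm_le_of_norm_deriv_le zero_le_one K.2 le_rfl (hV x hx)
      (by rw [hV0 x hx]; exact ContinuousLinearMap.norm_id_le) (fun t ht => by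
        rw [add_zero]
        refine (ContinuousLinearMap.opNorm_comp_le _ _).trans ?_
        gcongr
        exact hAK _ (hst x hx t ht)) t ht
    simpa using this
  refine ⟨V, fun x hx => ⟨hV0 x hx, fun t ht => (hV x hx t ht).continuousWithinAt⟩,
    fun t ht => ⟨fun x hx => ?_, fun x hx => ?_⟩⟩
  · refine HasFDerivWithinAt.of_isLittleO (Asymptotics.isLittleO_iff.2 fun c hc => ?_)
    -- The remainder w solves w' = A w + (linearization error). One factor M pays for the Lipschitz
    -- constant of the flow inside the error, the other for Grönwall.
    obtain ⟨δ, hδ, hlin⟩ := exists_linearization_modulus hf.1 (ε := c / (M * M)) (by positivity)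
    filter_upwards [self_mem_nhdsWithin,
      mem_nhdsWithin_of_mem_nhds (Metric.ball_mem_nhds x (div_pos hδ hM0))] with y hy hyx
    rw [Metric.mem_ball, dist_eq_norm, lt_div_iff₀ hM0] at hyx
    have hw := norm_le_of_norm_deriv_le (δ := 0) (K := K) (ε := c / (M * M) * (‖y - x‖ * M))
      (w := fun t => flowMap f y t - flowMap f x t - V x t (y - x))
      (w' := fun t => f (flowMap f y t, t) - f (flowMap f x t, t) - A x t (V x t (y - x)))
      le_rfl K.2 (by positivity)
      (fun s hs => (((hX y hy).2 s hs).2.sub ((hX x hx).2 s hs).2).sub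
        (by simpa using (hV x hx s hs).clm_apply (hasDerivWithinAt_const s _ (y - x))))
      (by simp [(hX y hy).1, (hX x hx).1, hV0 x hx]) (fun s hs => by
        have h1 := hlin s hs _ ((hX x hx).2 s hs).1 _ ((hX y hy).2 s hs).1
          (by rw [dist_eq_norm]; exact (hlip x hx y hy s hs).trans_lt hyx)
        have h2 := (A x s).le_of_opNorm_le (hAK _ (hst x hx s hs))
          (flowMap f y s - flowMap f x s - V x s (y - x))
        have h3 : c / (M * M) * ‖flowMap f y s - flowMap f x s‖ ≤ c / (M * M) * (‖y - x‖ * M) := by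
          gcongr
          exact hlip x hx y hy s hs
        refine le_trans (le_of_eq ?_) ((norm_add_le _ _).trans (add_le_add h2 (h1.trans h3)))
        congr 1
        simp only [A, map_sub]
        abel) t ht
    refine hw.trans (le_of_eq ?_)
    rw [← hM]
    field_simp
    ring
  · refine Metric.continuousWithinAt_iff.2 fun c hc => ?_
    -- One factor M bounds V, the other comes from Grönwall; the 2 makes the final inequality
    -- strict.
    obtain ⟨δ, hδ, hmod⟩ := exists_spaceDeriv_modulus hf.1 (ε := c / (2 * M * M)) (by positivity)
    refine ⟨δ / M, by positivity, fun {y} hy hyx => ?_⟩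
    rw [dist_eq_norm, lt_div_iff₀ hM0] at hyx
    have hw := norm_le_of_norm_deriv_le (δ := 0) (K := K) (ε := c / (2 * M * M) * M)
      (w := fun t => V y t - V x t) le_rfl K.2 (by positivity)
      (fun s hs => (hV y hy s hs).sub (hV x hx s hs))
      (by simp [hV0 y hy, hV0 x hx]) (fun s hs => by
        have h1 : ‖A y s - A x s‖ ≤ c / (2 * M * M) :=
          hmod s hs _ ((hX x hx).2 s hs).1 _ ((hX y hy).2 s hs).1
            (by rw [dist_eq_norm]; exact (hlip x hx y hy s hs).trans_lt hyx)
        have h2 : A y s ∘L V y s - A x s ∘L V x s =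
            A y s ∘L (V y s - V x s) + (A y s - A x s) ∘L V x s := by
          ext1 v
          simp
        rw [h2]
        refine (norm_add_le _ _).trans (add_le_add ?_ ?_)
        · refine (ContinuousLinearMap.opNorm_comp_le _ _).trans ?_
          gcongr
          exact hAK _ (hst y hy s hs)
        · refine (ContinuousLinearMap.opNorm_comp_le _ _).trans ?_
          gcongr
          exact hVM x hx s hs) t ht
    rw [dist_eq_norm]
    refine hw.trans_lt ?_
    have : (0 + c / (2 * M * M) * M) * M = c / 2 := by field_simp; ring
    rw [← hM, this]
    linarith

theorem contDiffOn_flowMap (hf : f ∈ admissibleFields d) {t : ℝ} (ht : t ∈ Icc (0 : ℝ) 1) :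
    ContDiffOn ℝ 1 (fun x => flowMap f x t) (unitCube d) := by
  obtain ⟨V, -, hV⟩ := exists_flowMap_deriv hf
  have := (contDiffOn_succ_iff_hasFDerivWithinAt_of_uniqueDiffOn (n := 0)
    (f := fun x => flowMap f x t) uniqueDiffOn_unitCube).2
    ⟨by simp, fun x => V x t, contDiffOn_zero.2 (hV t ht).2, (hV t ht).1⟩
  simpa using this

/-- The field `b f(x, a + b s)`, whose trajectories are those of `f` run from time `a` to time
`a + b`. -/
def rescaleField (f : EuclideanSpace ℝ (Fin d) × ℝ → EuclideanSpace ℝ (Fin d)) (a b : ℝ) :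
    EuclideanSpace ℝ (Fin d) × ℝ → EuclideanSpace ℝ (Fin d) :=
  fun p => b • f (p.1, a + b * p.2)

theorem add_mul_mem_Icc {a b : ℝ} (ha : a ∈ Icc (0 : ℝ) 1) (hab : a + b ∈ Icc (0 : ℝ) 1) {s : ℝ}
    (hs : s ∈ Icc (0 : ℝ) 1) : a + b * s ∈ Icc (0 : ℝ) 1 := by
  have := convex_Icc (0 : ℝ) 1 ha hab (sub_nonneg.2 hs.2) hs.1 (by ring)
  simpa [show (1 - s) * a + s * (a + b) = a + b * s by ring] using this

/-- Tangency survives multiplication by b of either sign, so time reversal (a = 1, b = -1) is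
covered along with shortening (a = 0, b = t). -/
theorem rescaleField_mem {a b : ℝ} (ha : a ∈ Icc (0 : ℝ) 1) (hab : a + b ∈ Icc (0 : ℝ) 1)
    (hf : f ∈ admissibleFields d) : rescaleField f a b ∈ admissibleFields d := by
  have hmaps : MapsTo (fun p : EuclideanSpace ℝ (Fin d) × ℝ => (p.1, a + b * p.2)) (spaceTime d)
      (spaceTime d) := fun p hp => ⟨hp.1, add_mul_mem_Icc ha hab hp.2⟩
  refine ⟨(hf.1.comp (by fun_prop) hmaps).const_smul b, fun x hx ν hν t ht => ?_⟩
  rw [rescaleField, inner_smul_left, hf.2 x hx ν hν _ (add_mul_mem_Icc ha hab ht), mul_zero]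

theorem IsTrajectory.rescale {a b : ℝ} (ha : a ∈ Icc (0 : ℝ) 1) (hab : a + b ∈ Icc (0 : ℝ) 1)
    {x : EuclideanSpace ℝ (Fin d)} {γ : ℝ → EuclideanSpace ℝ (Fin d)} (h : IsTrajectory f x γ) :
    IsTrajectory (rescaleField f a b) (γ a) fun s => γ (a + b * s) := by
  refine ⟨by simp, fun s hs => ⟨(h.2 _ (add_mul_mem_Icc ha hab hs)).1, ?_⟩⟩
  have hin : HasDerivWithinAt (fun s : ℝ => a + b * s) b (Icc 0 1) s := by
    simpa using (((hasDerivAt_id s).const_mul b).const_add a).hasDerivWithinAt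
  exact (h.2 _ (add_mul_mem_Icc ha hab hs)).2.scomp s hin fun s hs => add_mul_mem_Icc ha hab hs

theorem transportMap_rescaleField {a b : ℝ} (ha : a ∈ Icc (0 : ℝ) 1)
    (hab : a + b ∈ Icc (0 : ℝ) 1) (hf : f ∈ admissibleFields d) {x : EuclideanSpace ℝ (Fin d)}
    (hx : x ∈ unitCube d) :
    transportMap (rescaleField f a b) (flowMap f x a) = flowMap f x (a + b) := by
  have hX := isTrajectory_flowMap hf hx
  have := (isTrajectory_flowMap (rescaleField_mem ha hab hf) (hX.2 a ha).1).eqOn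
    (rescaleField_mem ha hab hf).1 (hX.rescale ha hab) (right_mem_Icc.2 zero_le_one)
  simpa [transportMap] using this

theorem mapsTo_transportMap (hf : f ∈ admissibleFields d) :
    MapsTo (transportMap f) (unitCube d) (unitCube d) := fun _ hx =>
  ((isTrajectory_flowMap hf hx).2 1 (by simp)).1

theorem leftInvOn_transportMap (hf : f ∈ admissibleFields d) :
    LeftInvOn (transportMap (rescaleField f 1 (-1))) (transportMap f) (unitCube d) := fun x hx => by
  have := transportMap_rescaleField (a := 1) (b := -1) (by simp) (by simp) hf hx
  rwa [add_neg_cancel, (isTrajectory_flowMap hf hx).1] at this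

theorem rescaleField_reverse_reverse :
    rescaleField (rescaleField f 1 (-1)) 1 (-1) = f := by
  funext p
  simp [rescaleField]

/-- Time reversal is an involution, so the left inverse property of the reversed field is the right
inverse property of the original. -/
theorem invOn_transportMap (hf : f ∈ admissibleFields d) :
    InvOn (transportMap (rescaleField f 1 (-1))) (transportMap f) (unitCube d) (unitCube d) := by
  refine ⟨leftInvOn_transportMap hf, ?_⟩
  have := leftInvOn_transportMap (rescaleField_mem (a := 1) (b := -1) (by simp) (by simp) hf)
  rwa [rescaleField_reverse_reverse] at this

theorem isC1Diffeo_of_invOn {K : Set (EuclideanSpace ℝ (Fin d))}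
    {T S : EuclideanSpace ℝ (Fin d) → EuclideanSpace ℝ (Fin d)} (h : InvOn S T K K)
    (hTK : MapsTo T K K) (hSK : MapsTo S K K) (hT : ContDiffOn ℝ 1 T K) (hS : ContDiffOn ℝ 1 S K) :
    IsC1Diffeo K T := by
  have hbij := h.bijOn hTK hSK
  refine ⟨hbij, hT, hS.congr fun y hy => ?_⟩
  exact hbij.injOn (hbij.surjOn.mapsTo_invFunOn hy) (hSK hy)
    ((hbij.surjOn.rightInvOn_invFunOn hy).trans (h.2 hy).symm)

theorem isC1Diffeo_flowMap (hf : f ∈ admissibleFields d) {t : ℝ} (ht : t ∈ Icc (0 : ℝ) 1) :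
    IsC1Diffeo (unitCube d) fun x => flowMap f x t := by
  have h0 : (0 : ℝ) ∈ Icc (0 : ℝ) 1 := by simp
  have h0t : 0 + t ∈ Icc (0 : ℝ) 1 := by simpa using ht
  have hg := rescaleField_mem h0 h0t hf
  have hr := rescaleField_mem (a := 1) (b := -1) (by simp) (by simp) hg
  have heq : EqOn (transportMap (rescaleField f 0 t)) (fun x => flowMap f x t) (unitCube d) :=
    fun x hx => by
      have := transportMap_rescaleField h0 h0t hf hx
      rwa [zero_add, (isTrajectory_flowMap hf hx).1] at this
  refine isC1Diffeo_of_invOn (S := transportMap (rescaleField (rescaleField f 0 t) 1 (-1)))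
    ⟨fun x hx => ?_, fun x hx => ?_⟩ ((mapsTo_transportMap hg).congr heq) (mapsTo_transportMap hr)
    (contDiffOn_flowMap hf ht) (contDiffOn_flowMap hr (by simp))
  · rw [← heq hx]
    exact (invOn_transportMap hg).1 hx
  · rw [← heq (mapsTo_transportMap hr hx)]
    exact (invOn_transportMap hg).2 hx

/-- Chain rule for the inverse composed with T. Derivatives within the cube are unique even at its
boundary, so the product of the two determinants is 1. -/
theorem IsC1Diffeo.jacobianDet_ne_zero {T : EuclideanSpace ℝ (Fin d) → EuclideanSpace ℝ (Fin d)}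
    (h : IsC1Diffeo (unitCube d) T) {x : EuclideanSpace ℝ (Fin d)} (hx : x ∈ unitCube d) :
    jacobianDet (unitCube d) T x ≠ 0 := by
  obtain ⟨hbij, hT, hS⟩ := h
  have hT' := (hT.differentiableOn one_ne_zero x hx).hasFDerivWithinAt
  have hS' := (hS.differentiableOn one_ne_zero (T x) (hbij.mapsTo hx)).hasFDerivWithinAt
  have hcomp := (hS'.comp x hT' hbij.mapsTo).congr
    (fun y hy => (hbij.injOn.leftInvOn_invFunOn hy).symm) (hbij.injOn.leftInvOn_invFunOn hx).symm
  have hid := (uniqueDiffOn_unitCube x hx).eq hcomp (hasFDerivWithinAt_id x _)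
  have hdet := congrArg ContinuousLinearMap.det hid
  intro h0
  rw [jacobianDet] at h0
  simp only [ContinuousLinearMap.det, ContinuousLinearMap.toLinearMap_comp,
    LinearMap.det_comp] at hdet h0
  rw [h0] at hdet
  simp at hdet

/-- A nonpositive value at time t would, by the intermediate value theorem from det = 1 at time 0,
force a zero at some s ≤ t, where the flow map is also a diffeomorphism. -/
theorem jacobianDet_flowMap_pos (hf : f ∈ admissibleFields d) {t : ℝ} (ht : t ∈ Icc (0 : ℝ) 1)
    {x : EuclideanSpace ℝ (Fin d)} (hx : x ∈ unitCube d) :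
    0 < jacobianDet (unitCube d) (fun y => flowMap f y t) x := by
  obtain ⟨V, hV0, hV⟩ := exists_flowMap_deriv hf
  have hJ : ∀ s ∈ Icc (0 : ℝ) 1,
      jacobianDet (unitCube d) (fun y => flowMap f y s) x = (V x s).det := fun s hs => by
    rw [jacobianDet, ((hV s hs).1 x hx).fderivWithin (uniqueDiffOn_unitCube x hx)]
  have hc : ContinuousOn (fun s => (V x s).det) (Icc 0 t) :=
    ContinuousLinearMap.continuous_det.comp_continuousOn
      ((hV0 x hx).2.mono (Icc_subset_Icc_right ht.2))
  rw [hJ t ht]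
  by_contra! hneg
  have h1 : (V x 0).det = 1 := by
    rw [(hV0 x hx).1]
    simp [ContinuousLinearMap.det]
  obtain ⟨s, hs, hs0⟩ := intermediate_value_Icc' ht.1 hc ⟨hneg, by rw [h1]; exact zero_le_one⟩
  have hs' : s ∈ Icc (0 : ℝ) 1 := ⟨hs.1, hs.2.trans ht.2⟩
  exact (isC1Diffeo_flowMap hf hs').jacobianDet_ne_zero hx ((hJ s hs').trans hs0)

end Flow

/-! ### Change of variables for densities -/

section Density

variable {d : ℕ} {K : Set (EuclideanSpace ℝ (Fin d))}
  {T : EuclideanSpace ℝ (Fin d) → EuclideanSpace ℝ (Fin d)} {ρ : EuclideanSpace ℝ (Fin d) → ℝ}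

theorem pullbackDensity_eq_indicator :
    (fun x => ENNReal.ofReal (pullbackDensity K T ρ x)) =
      K.indicator fun x => ENNReal.ofReal |jacobianDet K T x| * ENNReal.ofReal (ρ (T x)) := by
  funext x
  by_cases hx : x ∈ K
  · simp [pullbackDensity, hx, mul_comm (ρ (T x)), ENNReal.ofReal_mul (abs_nonneg _)]
  · simp [pullbackDensity, hx]

/-- The inverse is controlled only on K, but the measure does not charge the complement. -/
theorem IsC1Diffeo.aemeasurable_invFunOn (hK : MeasurableSet K) (hT : IsC1Diffeo K T)
    (hρ : IsDensityOn K ρ) : AEMeasurable (Function.invFunOn T K) (densityMeasure ρ) := by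
  have h : AEMeasurable (Function.invFunOn T K) ((densityMeasure ρ).restrict K) :=
    hT.2.2.continuousOn.aemeasurable hK
  rwa [Measure.restrict_eq_self_of_ae_mem] at h
  rw [ae_iff, densityMeasure, withDensity_apply' _ _]
  refine setLIntegral_eq_zero hK.compl fun x hx => ?_
  have : ρ x = 0 := by_contra fun h => hx (hρ.support_subset h)
  simp [this]

theorem IsC1Diffeo.densityMeasure_pullbackDensity (hK : MeasurableSet K) (hT : IsC1Diffeo K T)
    (hρ : IsDensityOn K ρ) :
    densityMeasure (pullbackDensity K T ρ) =
      (densityMeasure ρ).map (Function.invFunOn T K) := by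
  have hind : (fun x => ENNReal.ofReal (ρ x)) = K.indicator fun x => ENNReal.ofReal (ρ x) := by
    refine (indicator_eq_self.2 fun x hx => hρ.support_subset ?_).symm
    intro h
    simp [h] at hx
  ext A hA
  -- Turning the preimage under the inverse into an image under T brings it to the form of the area
  -- formula.
  have himg : K ∩ Function.invFunOn T K ⁻¹' A = T '' (A ∩ K) := by
    ext y
    constructor
    · rintro ⟨hy, hyA⟩
      exact ⟨_, ⟨hyA, hT.1.surjOn.mapsTo_invFunOn hy⟩, hT.1.surjOn.rightInvOn_invFunOn hy⟩
    · rintro ⟨x, ⟨hxA, hx⟩, rfl⟩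
      refine ⟨hT.1.mapsTo hx, ?_⟩
      rwa [mem_preimage, hT.1.injOn.leftInvOn_invFunOn hx]
  rw [Measure.map_apply_of_aemeasurable (hT.aemeasurable_invFunOn hK hρ) hA, densityMeasure,
    densityMeasure, withDensity_apply' _ _, withDensity_apply' _ _, pullbackDensity_eq_indicator,
    hind, lintegral_indicator hK, lintegral_indicator hK, Measure.restrict_restrict hK,
    Measure.restrict_restrict hK, himg, inter_comm K A]
  exact (lintegral_image_eq_lintegral_abs_det_fderiv_mul volume (hA.inter hK)
    (fun x hx => (hT.2.1.differentiableOn one_ne_zero x hx.2).hasFDerivWithinAt.mono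
      inter_subset_right) (hT.1.injOn.mono inter_subset_right)
    fun y => ENNReal.ofReal (ρ y)).symm

theorem IsC1Diffeo.isDensityOn_pullbackDensity (hK : MeasurableSet K) (hKu : UniqueDiffOn ℝ K)
    (hT : IsC1Diffeo K T) (hρ : IsDensityOn K ρ) : IsDensityOn K (pullbackDensity K T ρ) where
  aemeasurable := by
    refine (aemeasurable_indicator_iff hK).2 (AEMeasurable.mul ?_ ?_)
    -- Since ρ is only a.e. measurable, composing with T requires that T pull null sets back to null
    -- sets; these preimages are images under the differentiable inverse.
    · have hTm : AEMeasurable T (volume.restrict K) := hT.2.1.continuousOn.aemeasurable hK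
      refine (hρ.aemeasurable.mono_ac ?_).comp_aemeasurable hTm
      refine Measure.AbsolutelyContinuous.mk fun N hN hN0 => ?_
      rw [Measure.map_apply_of_aemeasurable hTm hN, Measure.restrict_apply' hK]
      refine measure_mono_null (t := Function.invFunOn T K '' (N ∩ K)) ?_
        (addHaar_image_eq_zero_of_differentiableOn_of_addHaar_eq_zero volume
          ((hT.2.2.differentiableOn one_ne_zero).mono inter_subset_right)
          (measure_mono_null inter_subset_left hN0))
      rintro x ⟨hxN, hx⟩
      exact ⟨T x, ⟨hxN, hT.1.mapsTo hx⟩, hT.1.injOn.leftInvOn_invFunOn hx⟩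
    · refine ContinuousOn.aemeasurable ?_ hK
      exact (ContinuousLinearMap.continuous_det.comp_continuousOn
        (hT.2.1.continuousOn_fderivWithin hKu le_rfl)).abs
  nonneg := fun x => indicator_nonneg (fun _ _ => mul_nonneg (hρ.nonneg _) (abs_nonneg _)) x
  support_subset := support_indicator_subset
  lintegral_eq_one := by
    -- Pushforward preserves total mass.
    have h := congrArg (fun μ => μ univ) (hT.densityMeasure_pullbackDensity hK hρ)
    beta_reduce at h
    rw [Measure.map_apply_of_aemeasurable (hT.aemeasurable_invFunOn hK hρ) MeasurableSet.univ,
      preimage_univ, densityMeasure, densityMeasure, withDensity_apply' _ _,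
      withDensity_apply' _ _, Measure.restrict_univ, hρ.lintegral_eq_one] at h
    exact h

end Density

theorem mainTheorem12 (d : ℕ) (hd : 1 ≤ d)
    (f : EuclideanSpace ℝ (Fin d) × ℝ → EuclideanSpace ℝ (Fin d))
    (hf : f ∈ admissibleFields d) :
    -- the flow is well defined: trajectories in the cube exist and are unique
    (∀ x ∈ unitCube d, IsTrajectory f x (flowMap f x) ∧
      ∀ γ, IsTrajectory f x γ → EqOn γ (flowMap f x) (Icc 0 1)) ∧
    -- every time-`t` flow map, in particular the time-one map, is a diffeomorphism of the cube
    (∀ t ∈ Icc (0 : ℝ) 1, IsC1Diffeo (unitCube d) fun x => flowMap f x t) ∧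
    IsC1Diffeo (unitCube d) (transportMap f) ∧
    -- the pullback density is the density of the image of `ρ(x) dx` under the inverse of the
    -- time-one map, and it is given by the formula without absolute value
    ∀ ρ : EuclideanSpace ℝ (Fin d) → ℝ, IsDensityOn (unitCube d) ρ →
      IsDensityOn (unitCube d) (pullbackDensity (unitCube d) (transportMap f) ρ) ∧
      densityMeasure (pullbackDensity (unitCube d) (transportMap f) ρ) =
        (densityMeasure ρ).map (Function.invFunOn (transportMap f) (unitCube d)) ∧
      ∀ x ∈ unitCube d, pullbackDensity (unitCube d) (transportMap f) ρ x =
        ρ (transportMap f x) * jacobianDet (unitCube d) (transportMap f) x := by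
  have h1 : (1 : ℝ) ∈ Icc (0 : ℝ) 1 := by simp
  have hT : IsC1Diffeo (unitCube d) (transportMap f) := isC1Diffeo_flowMap hf h1
  have hm : MeasurableSet (unitCube d) := isClosed_unitCube.measurableSet
  refine ⟨fun x hx => ⟨isTrajectory_flowMap hf hx, fun γ hγ =>
    hγ.eqOn hf.1 (isTrajectory_flowMap hf hx)⟩, fun t ht => isC1Diffeo_flowMap hf ht, hT,
    fun ρ hρ => ⟨hT.isDensityOn_pullbackDensity hm uniqueDiffOn_unitCube hρ,
      hT.densityMeasure_pullbackDensity hm hρ, fun x hx => ?_⟩⟩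
  have hJ : 0 < jacobianDet (unitCube d) (transportMap f) x := jacobianDet_flowMap_pos hf h1 hx
  rw [pullbackDensity, indicator_of_mem hx, abs_of_pos hJ]
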